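/- All graphs are finite and simple. The density $d(G)$ of a graph $G$ with at least one vertex is its number of edges divided by its number of vertices, and $G$ is strictly balanced if $d(H)<d(G)$ for every subgraph $H\neq G$ of $G$ with at least one vertex (subgraphs need not be induced). Let $F$ be a strictly balanced graph with $\ell\ge 1$ edges, density $d$ and $\mathfrak{a}$ automorphisms, let $c>0$ be a constant, and let $m=m(n)$ be a sequence of nonnegative integers such that $m\to\infty$ and $m\sim c\,n^{2-1/d}$ as $n\to\infty$. Let $G$ be uniformly distributed on the set of graphs with vertex set $\{1,\dots,n\}$ and exactly $m$ edges (this set is nonempty for all large $n$), and let $G[F]$ be the number of subgraphs of $G$ that are isomorphic to $F$. Then $G[F]$ converges in distribution to the Poisson law of parameter $\lambda=(2c)^{\ell}/\mathfrak{a}$; that is, for every integer $t\ge 0$, $$\lim_{n\to\infty}\mathbb{P}\bigl(G[F]=t\bigr)=\frac{\lambda^{t}}{t!}\,e^{-\lambda}.$$ (The condition $m\to\infty$ excludes only the case where $F$ is a single edge; for every other such $F$ it follows from $m\sim c\,n^{2-1/d}$.) -/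

import Mathlib

open Filter Topology Asymptotics

noncomputable section

/-- The density of a (finite) graph: number of edges divided by number of vertices. -/
def graphDensity {V : Type*} (F : SimpleGraph V) : ℝ :=
  (F.edgeSet.ncard : ℝ) / (Nat.card V : ℝ)

/-- A graph is strictly balanced if its density is larger than the density of each of its strict
subgraphs (with at least one vertex, so that the density makes sense). -/
def IsStrictlyBalanced {V : Type*} (F : SimpleGraph V) : Prop :=
  ∀ H : F.Subgraph, H ≠ ⊤ → H.verts.Nonempty → graphDensity H.coe < graphDensity F

/-- The set of `(n,m)`-graphs: graphs on `n` labeled vertices with exactly `m` edges. -/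
def nmGraphs (n m : ℕ) : Set (SimpleGraph (Fin n)) :=
  {G | G.edgeSet.ncard = m}

/-- The probability that a uniformly random `(n,m)`-graph satisfies the property `A`. -/
def nmProb (n m : ℕ) (A : SimpleGraph (Fin n) → Prop) : ℝ :=
  ({G | G ∈ nmGraphs n m ∧ A G}.ncard : ℝ) / ((nmGraphs n m).ncard : ℝ)

end

/-! The proof uses binomial moments. Write X for the number of copies, N = C(n,2), p(e) =
C(m,e)/C(N,e). By `nmProb_ge` a fixed graph with e edges lies in G with probability p(e) ~ (2c)^e
n^(-e/d), so E[C(X,r)] is the sum of p(e(S)) over r-sets of copies of F in the complete graph, where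
e(S) counts the edges of the union of S.

If the copies in S are vertex-disjoint, the union has e = dv, and such families produce λ^r/r!.
Otherwise strict balance forces e > dv (`excess_sup_finset_pos`). Only O(n^v) families span v
vertices (`card_filter_support_le`), so they contribute O(n^(v-e/d)) → 0, and finitely many pairs
(v,e) occur. This gives `tendsto_nmExp_choose_copyCount`.

Bonferroni inequalities then trap P(X = t) between finite combinations of binomial moments, whose
limits are partial sums of the series for λ^t/t! · exp(-λ). -/

/-! ### Strict balance and the excess of unions of copies -/

section Structure

variable {V : Type*} [Fintype V] {F : SimpleGraph V}

lemma nonempty_of_graphDensity_pos (hd : 0 < graphDensity F) : Nonempty V := by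
  by_contra h
  rw [not_nonempty_iff] at h
  simp [graphDensity] at hd

lemma graphDensity_mul_card (hd : 0 < graphDensity F) :
    graphDensity F * (Fintype.card V : ℝ) = F.edgeSet.ncard := by
  have := nonempty_of_graphDensity_pos hd
  have : (Fintype.card V : ℝ) ≠ 0 := by exact_mod_cast Fintype.card_ne_zero
  rw [graphDensity, Nat.card_eq_fintype_card]
  field_simp

lemma edgeSet_ncard_pos_of_graphDensity_pos (hd : 0 < graphDensity F) : 0 < F.edgeSet.ncard := by
  rcases Nat.eq_zero_or_pos F.edgeSet.ncard with h | h
  · simp [graphDensity, h] at hd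
  · exact h

/-- Restates strict balance without subtypes. `W` may contain isolated vertices of `F'`, as happens
for intersections of supports. -/
lemma IsStrictlyBalanced.ncard_edgeSet_lt (hF : IsStrictlyBalanced F) {F' : SimpleGraph V}
    (hle : F' ≤ F) {W : Set V} (hW : W.Nonempty) (hsupp : F'.support ⊆ W)
    (hne : W ≠ Set.univ ∨ F' ≠ F) :
    (F'.edgeSet.ncard : ℝ) < graphDensity F * W.ncard := by
  let H : F.Subgraph :=
    { verts := W
      Adj := F'.Adj
      adj_sub := fun h => hle h
      edge_vert := fun h => hsupp h.mem_support_left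
      symm := F'.symm }
  have hH : H ≠ ⊤ := by
    intro h
    rcases hne with h1 | h1
    · exact h1 (congrArg SimpleGraph.Subgraph.verts h)
    · apply h1
      ext u v
      have := congrFun (congrFun (congrArg SimpleGraph.Subgraph.Adj h) u) v
      simpa [H] using this
  have key := hF H hH hW
  have hWpos : (0 : ℝ) < W.ncard := by
    exact_mod_cast (Set.ncard_pos (Set.toFinite W)).2 hW
  have hmap : H.coe.edgeSet.ncard = F'.edgeSet.ncard := by
    have : F'.edgeSet = Sym2.map (Subtype.val : W → V) '' H.coe.edgeSet := by
      ext e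
      induction e with
      | h u v =>
        simp only [SimpleGraph.mem_edgeSet, Set.mem_image]
        constructor
        · intro h
          exact ⟨s(⟨u, hsupp h.mem_support_left⟩, ⟨v, hsupp h.mem_support_right⟩), h, rfl⟩
        · rintro ⟨e', he', h⟩
          induction e' with
          | h a b =>
            rw [Sym2.map_mk, ← SimpleGraph.mem_edgeSet] at *
            have he' : F'.Adj a b := he'
            rw [← h]
            exact he'
    rw [this, Set.ncard_image_of_injective _ (Sym2.map.injective Subtype.val_injective)]
  have hcard : Nat.card H.verts = W.ncard := rfl
  rw [graphDensity, hmap, hcard, div_lt_iff₀ hWpos] at key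
  exact key

/-- Deleting isolated vertices keeps all edges and would raise the density. -/
lemma IsStrictlyBalanced.support_eq_univ (hF : IsStrictlyBalanced F)
    (hd : 0 < graphDensity F) : F.support = Set.univ := by
  by_contra h
  have hne : F.support.Nonempty := by
    rw [Set.nonempty_iff_ne_empty]
    intro h0
    rw [SimpleGraph.support_eq_bot_iff] at h0
    have := edgeSet_ncard_pos_of_graphDensity_pos hd
    simp [h0] at this
  have h1 := hF.ncard_edgeSet_lt le_rfl hne subset_rfl (Or.inl h)
  have h2 : (F.support.ncard : ℝ) ≤ Fintype.card V := by
    exact_mod_cast (Set.ncard_le_card F.support).trans_eq Nat.card_eq_fintype_card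
  have := graphDensity_mul_card hd
  nlinarith

/-- The graphs on `U` which, up to isolated vertices, are isomorphic to `F`. -/
def graphCopies {V : Type*} (F : SimpleGraph V) (U : Type*) : Set (SimpleGraph U) :=
  Set.range fun φ : V ↪ U => F.map φ

variable {U : Type*}

/-- The number of edges of `H` in excess of `d` times the number of non-isolated vertices. -/
noncomputable def excess (d : ℝ) (H : SimpleGraph U) : ℝ := H.edgeSet.ncard - d * H.support.ncard

lemma ncard_edgeSet_map {W : Type*} (F : SimpleGraph W) (φ : W ↪ U) :
    (F.map φ).edgeSet.ncard = F.edgeSet.ncard := by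
  rw [SimpleGraph.edgeSet_map]
  exact Set.ncard_image_of_injective _ φ.sym2Map.injective

lemma ncard_edgeSet_of_mem_graphCopies {W : Type*} {F : SimpleGraph W} {B : SimpleGraph U} (hB : B ∈ graphCopies F U) :
    B.edgeSet.ncard = F.edgeSet.ncard := by
  obtain ⟨φ, rfl⟩ := hB
  exact ncard_edgeSet_map F φ

lemma support_sup_eq (A B : SimpleGraph U) : (A ⊔ B).support = A.support ∪ B.support := by
  ext; simp [SimpleGraph.mem_support, exists_or]

lemma ncard_support_of_mem_graphCopies (hF : IsStrictlyBalanced F) (hd : 0 < graphDensity F)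
    {B : SimpleGraph U} (hB : B ∈ graphCopies F U) : B.support.ncard = Fintype.card V := by
  obtain ⟨φ, rfl⟩ := hB
  rw [SimpleGraph.support_map, hF.support_eq_univ hd,
    Set.ncard_image_of_injective _ φ.injective, Set.ncard_univ, Nat.card_eq_fintype_card]

lemma excess_of_mem_graphCopies (hF : IsStrictlyBalanced F) (hd : 0 < graphDensity F)
    {B : SimpleGraph U} (hB : B ∈ graphCopies F U) : excess (graphDensity F) B = 0 := by
  rw [excess, ncard_edgeSet_of_mem_graphCopies hB, ncard_support_of_mem_graphCopies hF hd hB,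
    graphDensity_mul_card hd, sub_self]

/-- Pulled back along the embedding that defines `B`, the intersection becomes a subgraph of `F` on
the preimage of `A.support`. It misses an edge of `F` because `B` is not contained in `A`. -/
lemma ncard_edgeSet_inf_lt (hF : IsStrictlyBalanced F) (hd : 0 < graphDensity F)
    {A B : SimpleGraph U} (hB : B ∈ graphCopies F U)
    (hne : (A.support ∩ B.support).Nonempty) (hBA : ¬ B ≤ A) :
    ((A ⊓ B).edgeSet.ncard : ℝ) < graphDensity F * (A.support ∩ B.support).ncard := by
  obtain ⟨φ, rfl⟩ := hB
  have hsupp : (F.map φ).support = Set.range φ := by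
    rw [SimpleGraph.support_map, hF.support_eq_univ hd, Set.image_univ]
  have hinf : A ⊓ F.map φ = (A.comap φ ⊓ F).map φ := by
    ext u v
    simp only [SimpleGraph.inf_adj, SimpleGraph.map_adj, SimpleGraph.comap_adj]
    constructor
    · rintro ⟨h, a, b, hab, rfl, rfl⟩
      exact ⟨a, b, ⟨h, hab⟩, rfl, rfl⟩
    · rintro ⟨a, b, ⟨h, hab⟩, rfl, rfl⟩
      exact ⟨h, a, b, hab, rfl, rfl⟩
  have hinter : A.support ∩ (F.map φ).support = φ '' (φ ⁻¹' A.support) := by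
    rw [hsupp, Set.image_preimage_eq_inter_range]
  rw [hinf, ncard_edgeSet_map, hinter, Set.ncard_image_of_injective _ φ.injective]
  apply hF.ncard_edgeSet_lt inf_le_right
  · rw [hinter] at hne
    exact hne.of_image
  · rintro v ⟨w, hw⟩
    exact ⟨_, hw.1⟩
  · right
    intro h
    apply hBA
    rw [← inf_eq_right, hinf, h]

lemma excess_sup [Finite U] (d : ℝ) (A B : SimpleGraph U) :
    excess d (A ⊔ B) = excess d A + excess d B
      - ((A ⊓ B).edgeSet.ncard - d * (A.support ∩ B.support).ncard) := by
  have h1 := Set.ncard_union_add_ncard_inter A.edgeSet B.edgeSet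
  have h2 := Set.ncard_union_add_ncard_inter A.support B.support
  rw [← SimpleGraph.edgeSet_sup, ← SimpleGraph.edgeSet_inf] at h1
  rw [← support_sup_eq] at h2
  have h1' : ((A ⊔ B).edgeSet.ncard : ℝ) + (A ⊓ B).edgeSet.ncard
    = A.edgeSet.ncard + B.edgeSet.ncard := by exact_mod_cast h1
  have h2' : ((A ⊔ B).support.ncard : ℝ) + (A.support ∩ B.support).ncard
    = A.support.ncard + B.support.ncard := by exact_mod_cast h2
  simp only [excess]
  linear_combination h1' - d * h2'

/-- A copy has excess 0, and the correction term of `excess_sup` vanishes for disjoint supports and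
otherwise works in favour of the union, unless `B` adds nothing. -/
lemma excess_le_excess_sup [Finite U] (hF : IsStrictlyBalanced F) (hd : 0 < graphDensity F)
    (A : SimpleGraph U) {B : SimpleGraph U} (hB : B ∈ graphCopies F U) :
    excess (graphDensity F) A ≤ excess (graphDensity F) (A ⊔ B) := by
  by_cases hBA : B ≤ A
  · rw [sup_eq_left.2 hBA]
  rw [excess_sup, excess_of_mem_graphCopies hF hd hB]
  rcases (A.support ∩ B.support).eq_empty_or_nonempty with h | h
  · have : A ⊓ B = ⊥ := disjoint_iff.1
      (SimpleGraph.disjoint_of_disjoint_support _ (Set.disjoint_iff_inter_eq_empty.2 h))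
    simp [h, this]
  · linarith [ncard_edgeSet_inf_lt hF hd hB h hBA]

lemma excess_le_excess_sup_finset [Finite U] (hF : IsStrictlyBalanced F)
    (hd : 0 < graphDensity F) (A : SimpleGraph U) (S : Finset (SimpleGraph U))
    (hS : ∀ B ∈ S, B ∈ graphCopies F U) :
    excess (graphDensity F) A ≤ excess (graphDensity F) (A ⊔ S.sup id) := by
  classical
  induction S using Finset.induction_on with
  | empty => simp
  | insert B S _ ih =>
    rw [Finset.sup_insert, id, sup_comm B, ← sup_assoc]
    exact (ih fun C hC => hS C (Finset.mem_insert_of_mem hC)).trans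
      (excess_le_excess_sup hF hd _ (hS B (Finset.mem_insert_self _ _)))

lemma eq_of_le_of_mem_graphCopies [Finite U] {W : Type*} {F : SimpleGraph W} {A B : SimpleGraph U}
    (hA : A ∈ graphCopies F U) (hB : B ∈ graphCopies F U) (h : B ≤ A) : B = A := by
  rw [← SimpleGraph.edgeSet_inj]
  apply Set.eq_of_subset_of_ncard_le (SimpleGraph.edgeSet_mono h)
  rw [ncard_edgeSet_of_mem_graphCopies hA, ncard_edgeSet_of_mem_graphCopies hB]

/-- Two distinct copies sharing a vertex already have a union of positive excess, and adjoining the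
remaining copies cannot lower it. -/
lemma excess_sup_finset_pos [Finite U] (hF : IsStrictlyBalanced F)
    (hd : 0 < graphDensity F) {S : Finset (SimpleGraph U)}
    (hS : ∀ B ∈ S, B ∈ graphCopies F U)
    (hdisj : ¬ (S : Set (SimpleGraph U)).PairwiseDisjoint SimpleGraph.support) :
    0 < excess (graphDensity F) (S.sup id) := by
  simp only [Set.PairwiseDisjoint, Set.Pairwise, not_forall] at hdisj
  obtain ⟨A, hA, B, hB, hAB, hdisj⟩ := hdisj
  have hA : A ∈ S := hA
  have hB : B ∈ S := hB
  have hsup : S.sup id = (A ⊔ B) ⊔ S.sup id :=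
    (sup_eq_right.2 (sup_le (Finset.le_sup (f := id) hA) (Finset.le_sup (f := id) hB))).symm
  rw [hsup]
  refine lt_of_lt_of_le ?_ (excess_le_excess_sup_finset hF hd _ S hS)
  have hne : (A.support ∩ B.support).Nonempty := Set.not_disjoint_iff_nonempty_inter.1 hdisj
  have hBA : ¬ B ≤ A := fun h => hAB (eq_of_le_of_mem_graphCopies (hS A hA) (hS B hB) h).symm
  rw [excess_sup, excess_of_mem_graphCopies hF hd (hS A hA),
    excess_of_mem_graphCopies hF hd (hS B hB)]
  linarith [ncard_edgeSet_inf_lt hF hd (hS B hB) hne hBA]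

lemma ncard_edgeSet_sup_finset_le [Finite U] {S : Finset (SimpleGraph U)} {l : ℕ}
    (hS : ∀ B ∈ S, B.edgeSet.ncard = l) : (S.sup id).edgeSet.ncard ≤ S.card * l := by
  classical
  induction S using Finset.induction_on with
  | empty => simp
  | insert B S hBS ih =>
    rw [Finset.sup_insert, id, Finset.card_insert_of_notMem hBS, SimpleGraph.edgeSet_sup]
    have := ih fun C hC => hS C (Finset.mem_insert_of_mem hC)
    have h2 := hS B (Finset.mem_insert_self _ _)
    have := Set.ncard_union_le B.edgeSet (S.sup id).edgeSet
    linarith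

lemma ncard_support_sup_finset_le [Finite U] {S : Finset (SimpleGraph U)} {k : ℕ}
    (hS : ∀ B ∈ S, B.support.ncard = k) : (S.sup id).support.ncard ≤ S.card * k := by
  classical
  induction S using Finset.induction_on with
  | empty => simp
  | insert B S hBS ih =>
    rw [Finset.sup_insert, id, Finset.card_insert_of_notMem hBS, support_sup_eq]
    have := ih fun C hC => hS C (Finset.mem_insert_of_mem hC)
    have h2 := hS B (Finset.mem_insert_self _ _)
    have := Set.ncard_union_le B.support (S.sup id).support
    linarith

lemma support_sup_finset (S : Finset (SimpleGraph U)) :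
    (S.sup id).support = ⋃ B ∈ S, B.support := by
  classical
  induction S using Finset.induction_on with
  | empty => simp
  | insert B S hBS ih => rw [Finset.sup_insert, id, support_sup_eq, ih, Finset.set_biUnion_insert]

lemma ncard_edgeSet_sup_finset_eq [Finite U] {S : Finset (SimpleGraph U)} {l : ℕ}
    (hS : ∀ B ∈ S, B.edgeSet.ncard = l)
    (hdisj : (S : Set (SimpleGraph U)).PairwiseDisjoint SimpleGraph.support) :
    (S.sup id).edgeSet.ncard = S.card * l := by
  classical
  induction S using Finset.induction_on with
  | empty => simp
  | insert B S hBS ih =>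
    rw [Finset.sup_insert, id, Finset.card_insert_of_notMem hBS, SimpleGraph.edgeSet_sup]
    rw [Finset.coe_insert] at hdisj
    have h1 := ih (fun C hC => hS C (Finset.mem_insert_of_mem hC))
      (hdisj.subset (Set.subset_insert _ _))
    have h2 := hS B (Finset.mem_insert_self _ _)
    have h3 : Disjoint B.support (S.sup id).support := by
      rw [support_sup_finset, Set.disjoint_iUnion₂_right]
      intro C hC
      exact hdisj (Set.mem_insert _ _) (Set.mem_insert_of_mem _ hC) (fun h => hBS (h ▸ hC))
    rw [Set.ncard_union_eq, h1, h2]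
    · ring
    · exact SimpleGraph.disjoint_edgeSet.2 (SimpleGraph.disjoint_of_disjoint_support _ h3)

end Structure

/-! ### Counting copies, families of copies and graphs with m edges -/

section Counting

/-- Since `F` has no isolated vertices, the vertex set of a copy is determined by its edges, so
copies can be handled as graphs on all of `U`. -/
lemma copyCount_eq_ncard {V : Type*} [Fintype V] {F : SimpleGraph V} (hF : IsStrictlyBalanced F)
    (hd : 0 < graphDensity F) {U : Type*} [Fintype U] (G : SimpleGraph U) :
    G.copyCount F = {B | B ∈ graphCopies F U ∧ B ≤ G}.ncard := by
  classical
  have h1 : G.copyCount F = {H : G.Subgraph | Nonempty (F ≃g H.coe)}.ncard := by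
    rw [SimpleGraph.copyCount, ← Set.ncard_coe_finset]
    congr 1
    ext H
    simp
  rw [h1]
  have hverts : ∀ H : G.Subgraph, Nonempty (F ≃g H.coe) → H.verts = H.spanningCoe.support := by
    rintro H ⟨e⟩
    ext v
    constructor
    · intro hv
      have : e.symm ⟨v, hv⟩ ∈ F.support := by rw [hF.support_eq_univ hd]; trivial
      obtain ⟨w, hw⟩ := this
      have := e.map_rel_iff.2 hw
      rw [RelIso.apply_symm_apply] at this
      exact ⟨_, this⟩
    · rintro ⟨w, hw⟩
      exact H.edge_vert hw
  apply Set.ncard_congr (fun H _ => H.spanningCoe)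
  · rintro H ⟨e⟩
    refine ⟨⟨e.toEmbedding.toEmbedding.trans (Function.Embedding.subtype _), ?_⟩,
      H.spanningCoe_le⟩
    ext u v
    simp only [SimpleGraph.map_adj]
    constructor
    · rintro ⟨a, b, hab, rfl, rfl⟩
      exact e.map_rel_iff.2 hab
    · intro h
      have h : H.Adj u v := h
      refine ⟨e.symm ⟨u, H.edge_vert h⟩, e.symm ⟨v, H.edge_vert h.symm⟩, ?_, ?_, ?_⟩
      · exact e.symm.map_rel_iff.2 (show H.coe.Adj ⟨u, H.edge_vert h⟩ ⟨v, H.edge_vert h.symm⟩ from h)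
      · exact congrArg Subtype.val (e.apply_symm_apply ⟨u, H.edge_vert h⟩)
      · exact congrArg Subtype.val (e.apply_symm_apply ⟨v, H.edge_vert h.symm⟩)
  · intro H H' hH hH' h
    ext u v
    · rw [hverts H hH, hverts H' hH', h]
    · exact iff_of_eq (congrFun (congrFun (congrArg SimpleGraph.Adj h) u) v)
  · rintro B ⟨⟨φ, rfl⟩, hB⟩
    let f : F.Copy G := ⟨⟨φ, fun {a b} h => hB (SimpleGraph.map_adj_apply.2 h)⟩, φ.injective⟩
    refine ⟨f.toSubgraph, ⟨f.isoToSubgraph⟩, ?_⟩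
    ext u v
    simp only [SimpleGraph.Subgraph.spanningCoe_adj, SimpleGraph.Subgraph.map_adj,
      SimpleGraph.map_adj, Relation.Map]
    rfl

/-- Embeddings with the same image graph have the same range, namely its support, and hence differ
by an automorphism of `F`. -/
lemma ncard_map_fiber {V : Type*} [Fintype V] {F : SimpleGraph V} (hF : IsStrictlyBalanced F)
    (hd : 0 < graphDensity F) {U : Type*} (φ : V ↪ U) :
    Nat.card {ψ : V ↪ U // F.map ψ = F.map φ} = Nat.card (F ≃g F) := by
  symm
  apply Nat.card_congr
  refine Equiv.ofBijective
    (fun σ : F ≃g F => (⟨σ.toEmbedding.toEmbedding.trans φ, ?_⟩ :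
      {ψ : V ↪ U // F.map ψ = F.map φ})) ⟨?_, ?_⟩
  · ext u v
    simp only [SimpleGraph.map_adj]
    constructor
    · rintro ⟨a, b, hab, rfl, rfl⟩
      exact ⟨σ a, σ b, σ.map_rel_iff.2 hab, rfl, rfl⟩
    · rintro ⟨a, b, hab, rfl, rfl⟩
      exact ⟨σ.symm a, σ.symm b, σ.symm.map_rel_iff.2 hab, congrArg φ (σ.apply_symm_apply a),
        congrArg φ (σ.apply_symm_apply b)⟩
  · intro σ τ h
    ext v
    exact φ.injective (congrArg (fun ψ => ψ.1 v) h)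
  · rintro ⟨ψ, hψ⟩
    have hadj : ∀ (χ : V ↪ U) a b, (F.map χ).Adj (χ a) (χ b) ↔ F.Adj a b :=
      fun χ a b => SimpleGraph.map_adj_apply
    have hr : Set.range ψ = Set.range φ := by
      have := congrArg SimpleGraph.support hψ
      rwa [SimpleGraph.support_map, SimpleGraph.support_map, hF.support_eq_univ hd,
        Set.image_univ, Set.image_univ] at this
    have hex : ∀ v, ∃ w, φ w = ψ v := fun v => by
      have : ψ v ∈ Set.range φ := hr ▸ Set.mem_range_self v
      exact this
    choose f hf using hex
    have hfinj : Function.Injective f := fun a b h => ψ.injective (by rw [← hf, ← hf, h])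
    let σ : F ≃g F :=
      { Equiv.ofBijective f (Finite.injective_iff_bijective.1 hfinj) with
        map_rel_iff' := by
          intro a b
          change F.Adj (f a) (f b) ↔ F.Adj a b
          rw [← hadj φ, hf, hf, ← hψ, hadj ψ] }
    refine ⟨σ, ?_⟩
    apply Subtype.ext
    ext v
    exact hf v

lemma ncard_graphCopies_mul {V : Type*} [Fintype V] {F : SimpleGraph V}
    (hF : IsStrictlyBalanced F) (hd : 0 < graphDensity F) (n : ℕ) :
    (graphCopies F (Fin n)).ncard * Nat.card (F ≃g F) = n.descFactorial (Fintype.card V) := by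
  classical
  have h := Finset.card_eq_sum_card_image (fun φ : V ↪ Fin n => F.map φ) Finset.univ
  rw [Finset.card_univ, Fintype.card_embedding_eq, Fintype.card_fin] at h
  rw [h, Finset.sum_const_nat (m := Nat.card (F ≃g F))]
  · congr 1
    rw [← Set.ncard_coe_finset]
    congr 1
    ext B
    simp [graphCopies]
  · intro B hB
    obtain ⟨φ, -, rfl⟩ := Finset.mem_image.1 hB
    rw [← ncard_map_fiber hF hd φ, Nat.card_eq_fintype_card, Fintype.card_subtype]

/-- The number of finite families of graphs whose union has a given number of non-isolated
vertices is polynomially bounded. -/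
lemma card_filter_support_le (v n : ℕ) (T : Finset (Finset (SimpleGraph (Fin n))))
    (hT : ∀ S ∈ T, (S.sup id).support.ncard = v) :
    T.card ≤ Fintype.card (Finset (SimpleGraph (Fin v))) * n ^ v := by
  classical
  -- Families are grouped by the support `W` of their union: at most `n ^ v` choices of `W`, and for
  -- each one no more families than on `v` fixed vertices.
  have hT' : T ⊆ (Finset.powersetCard v (Finset.univ : Finset (Fin n))).biUnion
      (fun W => T.filter (fun S => (S.sup id).support.toFinset = W)) := by
    intro S hS
    simp only [Finset.mem_biUnion, Finset.mem_filter, Finset.mem_powersetCard_univ]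
    exact ⟨_, by rw [← Set.ncard_eq_toFinset_card', hT S hS], hS, rfl⟩
  refine (Finset.card_le_card hT').trans ((Finset.card_biUnion_le_card_mul _ _
    (Fintype.card (Finset (SimpleGraph (Fin v)))) ?_).trans ?_)
  · intro W hW
    rw [Finset.mem_powersetCard_univ] at hW
    let e : Fin v ≃ W := (Fintype.equivFinOfCardEq (by simpa using hW)).symm
    let ι : Fin v ↪ Fin n := e.toEmbedding.trans (Function.Embedding.subtype _)
    have hι : Set.range ι = W := by
      ext x
      simp only [Set.mem_range, Finset.mem_coe]
      constructor
      · rintro ⟨a, rfl⟩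
        exact (e a).2
      · intro hx
        exact ⟨e.symm ⟨x, hx⟩, congrArg Subtype.val (e.apply_symm_apply ⟨x, hx⟩)⟩
    rw [← Finset.card_univ]
    apply Finset.card_le_card_of_injOn (fun S => S.image (SimpleGraph.comap ι))
      (fun _ _ => Finset.mem_univ _)
    -- All members of `S` are supported in `W`, so restricting to `W` loses nothing; this gives
    -- injectivity.
    have hinv : ∀ S ∈ T.filter (fun S => (S.sup id).support.toFinset = W),
        (S.image (SimpleGraph.comap ι)).image (SimpleGraph.map ι) = S := by
      intro S hS
      rw [Finset.image_image]
      conv_rhs => rw [← Finset.image_id (s := S)]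
      apply Finset.image_congr
      intro B hB
      have hB : B ∈ S := hB
      simp only [Function.comp, id]
      refine le_antisymm (SimpleGraph.map_comap_le ι B) fun u v huv => ?_
      have hsub : B.support ⊆ Set.range ι := by
        rw [hι, ← (Finset.mem_filter.1 hS).2, Set.coe_toFinset]
        exact SimpleGraph.support_mono (Finset.le_sup (f := id) hB)
      obtain ⟨a, rfl⟩ := hsub huv.mem_support_left
      obtain ⟨b, rfl⟩ := hsub huv.mem_support_right
      exact SimpleGraph.map_adj_apply.2 huv
    intro S hS S' hS' h
    rw [← hinv S hS, ← hinv S' hS']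
    exact congrArg _ h
  · rw [Finset.card_powersetCard, Finset.card_univ, Fintype.card_fin, mul_comm]
    exact Nat.mul_le_mul_left _ (Nat.choose_le_pow _ _)

lemma ncard_edgeSet_top (n : ℕ) : (⊤ : SimpleGraph (Fin n)).edgeSet.ncard = n.choose 2 := by
  rw [← SimpleGraph.coe_edgeFinset, Set.ncard_coe_finset,
    SimpleGraph.card_edgeFinset_top_eq_card_choose_two, Fintype.card_fin]

/-- The number of `(n,m)`-graphs that contain a given graph. -/
lemma ncard_nmGraphs_ge {n : ℕ} (m : ℕ) (A : SimpleGraph (Fin n)) (hm : A.edgeSet.ncard ≤ m) :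
    {G | G ∈ nmGraphs n m ∧ A ≤ G}.ncard
      = (n.choose 2 - A.edgeSet.ncard).choose (m - A.edgeSet.ncard) := by
  classical
  have hA : A.edgeSet ⊆ (⊤ : SimpleGraph (Fin n)).edgeSet := SimpleGraph.edgeSet_mono le_top
  have hcard : ((⊤ : SimpleGraph (Fin n)).edgeSet \ A.edgeSet).toFinset.card
      = n.choose 2 - A.edgeSet.ncard := by
    rw [← Set.ncard_eq_toFinset_card', Set.ncard_sdiff hA, ncard_edgeSet_top]
  rw [← hcard, ← Finset.card_powersetCard, ← Set.ncard_coe_finset]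
  apply Set.ncard_congr (fun G _ => (G.edgeSet \ A.edgeSet).toFinset)
  · rintro G ⟨hG, hAG⟩
    rw [Finset.mem_coe, Finset.mem_powersetCard]
    constructor
    · rw [Set.toFinset_subset_toFinset]
      exact Set.sdiff_subset_sdiff_left (SimpleGraph.edgeSet_mono le_top)
    · rw [← Set.ncard_eq_toFinset_card', Set.ncard_sdiff (SimpleGraph.edgeSet_mono hAG)]
      rw [show G.edgeSet.ncard = m from hG]
  · rintro G G' ⟨-, hG⟩ ⟨-, hG'⟩ h
    rw [Set.toFinset_inj] at h
    rw [← SimpleGraph.edgeSet_inj, ← Set.sdiff_union_of_subset (SimpleGraph.edgeSet_mono hG), h,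
      Set.sdiff_union_of_subset (SimpleGraph.edgeSet_mono hG')]
  · intro s hs
    rw [Finset.mem_coe, Finset.mem_powersetCard, Set.subset_toFinset] at hs
    obtain ⟨hs, hsc⟩ := hs
    have hd : Disjoint A.edgeSet (s : Set (Sym2 (Fin n))) :=
      Set.disjoint_left.2 fun e he hes => (hs hes).2 he
    have hE : (SimpleGraph.fromEdgeSet (A.edgeSet ∪ s)).edgeSet = A.edgeSet ∪ s := by
      rw [SimpleGraph.edgeSet_fromEdgeSet, sdiff_eq_left, Set.disjoint_left]
      rintro e (he | he)
      · exact SimpleGraph.not_isDiag_of_mem_edgeSet _ he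
      · exact SimpleGraph.not_isDiag_of_mem_edgeSet _ (hs he).1
    refine ⟨SimpleGraph.fromEdgeSet (A.edgeSet ∪ s), ⟨?_, ?_⟩, ?_⟩
    · change Set.ncard _ = m
      rw [hE, Set.ncard_union_eq hd, Set.ncard_coe_finset, hsc]
      omega
    · rw [← SimpleGraph.edgeSet_subset_edgeSet, hE]
      exact Set.subset_union_left
    · refine Finset.ext fun e => (@Set.mem_toFinset _ _ (_) e).trans ?_
      rw [hE, Set.union_sdiff_left, hd.symm.sdiff_eq_left, Finset.mem_coe]

lemma ncard_nmGraphs (n m : ℕ) : (nmGraphs n m).ncard = (n.choose 2).choose m := by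
  have := ncard_nmGraphs_ge m (⊥ : SimpleGraph (Fin n)) (by simp)
  simpa using this

/-- The identity C(N,m) C(m,e) = C(N,e) C(N-e,m-e) yields a ratio whose lower indices stay fixed as
n grows. -/
lemma nmProb_ge {n m : ℕ} (A : SimpleGraph (Fin n)) (hA : A.edgeSet.ncard ≤ m)
    (hm : m ≤ n.choose 2) :
    nmProb n m (A ≤ ·)
      = (m.choose A.edgeSet.ncard : ℝ) / ((n.choose 2).choose A.edgeSet.ncard : ℝ) := by
  have hA' : A.edgeSet.ncard ≤ n.choose 2 := hA.trans hm
  rw [nmProb, ncard_nmGraphs_ge m A hA, ncard_nmGraphs, div_eq_div_iff]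
  · have := Nat.choose_mul (n := n.choose 2) hA
    rw [mul_comm] at this
    rw [mul_comm]
    exact_mod_cast this.symm.trans (mul_comm _ _) |>.trans (mul_comm _ _)
  · exact_mod_cast (Nat.choose_pos hm).ne'
  · exact_mod_cast (Nat.choose_pos hA').ne'

open Classical in
/-- The expectation of a function of a uniformly random `(n,m)`-graph. -/
noncomputable def nmExp (n m : ℕ) (f : SimpleGraph (Fin n) → ℝ) : ℝ :=
  (∑ G with G ∈ nmGraphs n m, f G) / ((nmGraphs n m).ncard : ℝ)

open Classical in
lemma nmProb_eq_nmExp (n m : ℕ) (A : SimpleGraph (Fin n) → Prop) :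
    nmProb n m A = nmExp n m (fun G => if A G then 1 else 0) := by
  rw [nmProb, nmExp, Finset.sum_boole, ← Set.ncard_coe_finset]
  congr 3
  ext G
  simp

lemma nmExp_mono {n m : ℕ} {f g : SimpleGraph (Fin n) → ℝ} (h : ∀ G, f G ≤ g G) :
    nmExp n m f ≤ nmExp n m g :=
  div_le_div_of_nonneg_right (Finset.sum_le_sum fun G _ => h G) (Nat.cast_nonneg _)

lemma nmExp_sum {n m : ℕ} {ι : Type*} (s : Finset ι) (f : ι → SimpleGraph (Fin n) → ℝ) :
    nmExp n m (fun G => ∑ i ∈ s, f i G) = ∑ i ∈ s, nmExp n m (f i) := by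
  simp only [nmExp]
  rw [Finset.sum_comm, Finset.sum_div]

lemma nmExp_const_mul {n m : ℕ} (a : ℝ) (f : SimpleGraph (Fin n) → ℝ) :
    nmExp n m (fun G => a * f G) = a * nmExp n m f := by
  simp only [nmExp]
  rw [← Finset.mul_sum, mul_div_assoc]

open Classical in
/-- The binomial moments of the number of copies of `F`. -/
lemma nmExp_choose_copyCount {V : Type*} [Fintype V] {F : SimpleGraph V}
    (hF : IsStrictlyBalanced F) (hd : 0 < graphDensity F) (n m r : ℕ) :
    nmExp n m (fun G => ((G.copyCount F).choose r : ℝ))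
      = ∑ S ∈ (graphCopies F (Fin n)).toFinset.powersetCard r, nmProb n m (S.sup id ≤ ·) := by
  have h : ∀ G : SimpleGraph (Fin n), ((G.copyCount F).choose r : ℝ)
      = ∑ S ∈ (graphCopies F (Fin n)).toFinset.powersetCard r,
          if S.sup id ≤ G then 1 else 0 := by
    intro G
    rw [copyCount_eq_ncard hF hd, Set.ncard_eq_toFinset_card', ← Finset.card_powersetCard,
      Finset.sum_boole]
    congr 2
    ext S
    simp only [Finset.mem_powersetCard, Finset.mem_filter, Finset.sup_le_iff, id,
      Finset.subset_iff, Set.mem_toFinset, Set.mem_ofPred_eq]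
    grind
  simp_rw [h, nmExp_sum, nmProb_eq_nmExp]

end Counting

/-! ### Bonferroni inequalities and asymptotics of edge probabilities -/

section Asymptotics

/-- An alternating sum of binomial moments that approximates the indicator of `x = t`. -/
noncomputable def bonferroniSum (x t J : ℕ) : ℝ :=
  ∑ j ∈ Finset.range (J + 1), (-1 : ℝ) ^ j * (t + j).choose t * (x.choose (t + j) : ℝ)

lemma bonferroniSum_eq (x t J : ℕ) :
    bonferroniSum x t J
      = x.choose t * ∑ j ∈ Finset.range (J + 1), (-1 : ℝ) ^ j * ((x - t).choose j : ℝ) := by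
  rw [bonferroniSum, Finset.mul_sum]
  refine Finset.sum_congr rfl fun j _ => ?_
  have h := Nat.choose_mul (n := x) (k := t + j) (s := t) (Nat.le_add_right _ _)
  rw [Nat.add_sub_cancel_left] at h
  have h' : (x.choose (t + j) : ℝ) * (t + j).choose t = x.choose t * (x - t).choose j := by
    exact_mod_cast h
  linear_combination (-1 : ℝ) ^ j * h'

/-- A truncated alternating sum along a row of Pascal's triangle collapses to one term, so the
parity of `J` decides the sign of the error. -/
lemma bonferroniSum_of_gt {x t : ℕ} (h : t < x) (J : ℕ) :
    bonferroniSum x t J = (-1) ^ J * (x.choose t * (x - t - 1).choose J) := by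
  obtain ⟨y, rfl⟩ := Nat.exists_eq_add_of_lt h
  have h2 := Int.alternating_sum_range_choose_eq_choose (n := y) (m := J)
  rw [bonferroniSum_eq, show t + y + 1 - t = y + 1 by omega]
  have h3 : ∑ j ∈ Finset.range (J + 1), (-1 : ℝ) ^ j * ((y + 1).choose j : ℝ)
      = (-1) ^ J * (y.choose J : ℝ) := by
    exact_mod_cast h2
  rw [h3, Nat.add_sub_cancel]
  ring

lemma bonferroniSum_self (t J : ℕ) : bonferroniSum t t J = 1 := by
  rw [bonferroniSum_eq, Finset.sum_eq_single_of_mem 0 (by simp)]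
  · simp
  · intro j _ hj
    rw [Nat.sub_self, Nat.choose_eq_zero_of_lt (Nat.pos_of_ne_zero hj)]
    simp

lemma bonferroniSum_of_lt {x t : ℕ} (h : x < t) (J : ℕ) : bonferroniSum x t J = 0 := by
  rw [bonferroniSum_eq, Nat.choose_eq_zero_of_lt h]
  simp

lemma indicator_le_bonferroniSum (x t i : ℕ) :
    (if x = t then (1 : ℝ) else 0) ≤ bonferroniSum x t (2 * i) := by
  rcases lt_trichotomy x t with h | rfl | h
  · rw [if_neg h.ne, bonferroniSum_of_lt h]
  · rw [if_pos rfl, bonferroniSum_self]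
  · rw [if_neg h.ne', bonferroniSum_of_gt h, pow_mul]
    simp only [even_two, Even.neg_pow, one_pow, one_mul]
    positivity

lemma bonferroniSum_le_indicator (x t i : ℕ) :
    bonferroniSum x t (2 * i + 1) ≤ (if x = t then (1 : ℝ) else 0) := by
  rcases lt_trichotomy x t with h | rfl | h
  · rw [if_neg h.ne, bonferroniSum_of_lt h]
  · rw [if_pos rfl, bonferroniSum_self]
  · rw [if_neg h.ne', bonferroniSum_of_gt h, pow_succ, pow_mul]
    simp only [even_two, Even.neg_pow, one_pow, one_mul, neg_mul, neg_nonpos]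
    positivity

/-- First n → ∞ at a fixed truncation level i, then i → ∞; no uniformity in i is required. -/
lemma tendsto_of_forall_le_of_forall_le {P : ℕ → ℝ} {L U : ℕ → ℕ → ℝ} {l u : ℕ → ℝ} {s : ℝ}
    (hL : ∀ i n, L i n ≤ P n) (hU : ∀ i n, P n ≤ U i n)
    (hl : ∀ i, Tendsto (L i) atTop (𝓝 (l i))) (hu : ∀ i, Tendsto (U i) atTop (𝓝 (u i)))
    (hls : Tendsto l atTop (𝓝 s)) (hus : Tendsto u atTop (𝓝 s)) :
    Tendsto P atTop (𝓝 s) := by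
  rw [tendsto_order]
  constructor
  · intro a ha
    obtain ⟨i, hi⟩ := (hls.eventually_const_lt ha).exists
    filter_upwards [(hl i).eventually_const_lt hi] with n hn
    exact hn.trans_le (hL i n)
  · intro a ha
    obtain ⟨i, hi⟩ := (hus.eventually_lt_const ha).exists
    filter_upwards [(hu i).eventually_lt_const hi] with n hn
    exact (hU i n).trans_lt hn

lemma tendsto_poisson_partial_sum (lam : ℝ) (t : ℕ) :
    Tendsto (fun J => ∑ j ∈ Finset.range (J + 1),
      (-1 : ℝ) ^ j * (t + j).choose t * (lam ^ (t + j) / (t + j).factorial)) atTop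
      (𝓝 (lam ^ t / t.factorial * Real.exp (-lam))) := by
  have h1 : Tendsto (fun J => ∑ j ∈ Finset.range J, (-lam) ^ j / (j.factorial : ℝ)) atTop
      (𝓝 (Real.exp (-lam))) := by
    rw [Real.exp_eq_exp_ℝ]
    exact (NormedSpace.expSeries_div_hasSum_exp (-lam)).tendsto_sum_nat
  have h2 := (h1.comp (tendsto_add_atTop_nat 1)).const_mul (lam ^ t / (t.factorial : ℝ))
  refine h2.congr fun J => ?_
  rw [Function.comp, Finset.mul_sum]
  refine Finset.sum_congr rfl fun j _ => ?_
  have h3 : ((t + j).choose t : ℝ) * t.factorial * j.factorial = (t + j).factorial := by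
    have := Nat.choose_mul_factorial_mul_factorial (Nat.le_add_right t j)
    rw [Nat.add_sub_cancel_left] at this
    exact_mod_cast this
  have h4 : (t.factorial : ℝ) ≠ 0 := by positivity
  have h5 : (j.factorial : ℝ) ≠ 0 := by positivity
  have h6 : ((t + j).choose t : ℝ) ≠ 0 := by
    exact_mod_cast (Nat.choose_pos (Nat.le_add_right t j)).ne'
  rw [← h3, neg_pow]
  field_simp
  ring

lemma tendsto_nat_choose_two : Tendsto (fun n : ℕ => n.choose 2) atTop atTop := by
  refine tendsto_atTop_mono' _ ?_ (tendsto_sub_atTop_nat 1)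
  filter_upwards [eventually_ge_atTop 2] with n hn
  obtain ⟨k, rfl⟩ := Nat.exists_eq_add_of_le hn
  rw [Nat.choose_two_right]
  have : (2 + k - 1) * 2 ≤ (2 + k) * (2 + k - 1) := by nlinarith
  omega

variable {d c : ℝ} {m : ℕ → ℕ}

lemma tendsto_rpow_mul_div_choose_two
    (hm : (fun n : ℕ => (m n : ℝ)) ~[atTop] (fun n : ℕ => c * (n : ℝ) ^ (2 - 1 / d))) :
    Tendsto (fun n : ℕ => (n : ℝ) ^ (1 / d) * ((m n : ℝ) / (n.choose 2 : ℝ))) atTop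
      (𝓝 (2 * c)) := by
  have h1 := (IsEquivalent.refl (u := fun n : ℕ => (n : ℝ) ^ (1 / d)) (l := atTop)).mul
    (hm.div (isEquivalent_choose 2))
  refine h1.symm.tendsto_nhds (tendsto_const_nhds.congr' ?_)
  filter_upwards [eventually_gt_atTop 0] with n hn
  have hn : (0 : ℝ) < n := by exact_mod_cast hn
  have h2 : (n : ℝ) ^ (1 / d) * (n : ℝ) ^ (2 - 1 / d) = (n : ℝ) ^ 2 := by
    rw [← Real.rpow_add hn, ← Real.rpow_natCast]
    norm_num
  simp only [Pi.mul_apply, Pi.div_apply]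
  rw [show (n : ℝ) ^ (1 / d) * (c * (n : ℝ) ^ (2 - 1 / d) / ((n : ℝ) ^ 2 / (Nat.factorial 2 : ℝ)))
    = ((n : ℝ) ^ (1 / d) * (n : ℝ) ^ (2 - 1 / d)) * (c / ((n : ℝ) ^ 2 / (Nat.factorial 2 : ℝ))) by
      ring, h2]
  have : (Nat.factorial 2 : ℝ) = 2 := by norm_num
  rw [this]
  field_simp

/-- The edge density m/N is of order n^(-1/d), hence tends to 0. -/
lemma eventually_le_choose_two (hd : 0 < d)
    (hm : (fun n : ℕ => (m n : ℝ)) ~[atTop] (fun n : ℕ => c * (n : ℝ) ^ (2 - 1 / d))) :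
    ∀ᶠ n in atTop, m n ≤ n.choose 2 := by
  have h1 := tendsto_rpow_mul_div_choose_two hm
  have h2 : Tendsto (fun n : ℕ => (n : ℝ) ^ (-(1 / d))) atTop (𝓝 0) :=
    (tendsto_rpow_neg_atTop (by positivity)).comp tendsto_natCast_atTop_atTop
  have h3 := h1.mul h2
  rw [mul_zero] at h3
  filter_upwards [h3.eventually_lt_const one_pos, eventually_gt_atTop 0,
    tendsto_nat_choose_two.eventually_gt_atTop 0] with n hn hn0 hN
  have hn0 : (0 : ℝ) < n := by exact_mod_cast hn0
  have hN : (0 : ℝ) < n.choose 2 := by exact_mod_cast hN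
  rw [mul_right_comm, ← Real.rpow_add hn0, add_neg_cancel, Real.rpow_zero, one_mul,
    div_lt_one hN] at hn
  exact_mod_cast hn.le

/-- As m and N both tend to infinity, p(e) ~ (m/N)^e. -/
lemma tendsto_rpow_mul_choose_div_choose (hm_top : Tendsto m atTop atTop)
    (hm : (fun n : ℕ => (m n : ℝ)) ~[atTop] (fun n : ℕ => c * (n : ℝ) ^ (2 - 1 / d))) (e : ℕ) :
    Tendsto (fun n : ℕ => (n : ℝ) ^ (e / d) *
      (((m n).choose e : ℝ) / ((n.choose 2).choose e : ℝ))) atTop (𝓝 ((2 * c) ^ e)) := by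
  have h1 := (isEquivalent_choose e).comp_tendsto hm_top
  have h2 := (isEquivalent_choose e).comp_tendsto tendsto_nat_choose_two
  have h3 := (IsEquivalent.refl (u := fun n : ℕ => (n : ℝ) ^ (e / d)) (l := atTop)).mul
    (h1.div h2)
  refine h3.symm.tendsto_nhds (((tendsto_rpow_mul_div_choose_two hm).pow e).congr' ?_)
  filter_upwards [eventually_gt_atTop 0] with n hn
  have hf : (e.factorial : ℝ) ≠ 0 := by positivity
  simp only [Pi.mul_apply, Pi.div_apply, Function.comp]
  rw [div_div_div_cancel_right₀ hf, mul_pow, div_pow, ← Real.rpow_mul_natCast (Nat.cast_nonneg n),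
    one_div_mul_eq_div]

lemma tendsto_pow_mul_choose_div_choose_zero (hd : 0 < d) (hm_top : Tendsto m atTop atTop)
    (hm : (fun n : ℕ => (m n : ℝ)) ~[atTop] (fun n : ℕ => c * (n : ℝ) ^ (2 - 1 / d)))
    {v e : ℕ} (hve : d * v < e) :
    Tendsto (fun n : ℕ => (n : ℝ) ^ v *
      (((m n).choose e : ℝ) / ((n.choose 2).choose e : ℝ))) atTop (𝓝 0) := by
  have h1 := tendsto_rpow_mul_choose_div_choose hm_top hm e
  have hpos : 0 < e / d - v := by
    rw [sub_pos, lt_div_iff₀ hd]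
    linarith
  have h2 : Tendsto (fun n : ℕ => (n : ℝ) ^ (-(e / d - v))) atTop (𝓝 0) :=
    (tendsto_rpow_neg_atTop hpos).comp tendsto_natCast_atTop_atTop
  have h3 := h2.mul h1
  rw [zero_mul] at h3
  refine h3.congr' ?_
  filter_upwards [eventually_gt_atTop 0] with n hn
  have hn : (0 : ℝ) < n := by exact_mod_cast hn
  rw [← mul_assoc, ← Real.rpow_add hn, ← Real.rpow_natCast]
  congr 2
  ring

end Asymptotics

/-! ### Convergence of the binomial moments -/

section Moments

variable {V : Type*} [Fintype V] {F : SimpleGraph V} {c : ℝ} {m : ℕ → ℕ}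

lemma card_pos_aut (F : SimpleGraph V) : 0 < Nat.card (F ≃g F) := by
  classical
  have : Nonempty (F ≃g F) := ⟨SimpleGraph.Iso.refl⟩
  have : Finite (F ≃g F) := DFunLike.finite _
  exact Nat.card_pos

lemma isEquivalent_ncard_graphCopies (hF : IsStrictlyBalanced F) (hd : 0 < graphDensity F) :
    (fun n : ℕ => ((graphCopies F (Fin n)).ncard : ℝ)) ~[atTop]
      (fun n : ℕ => (n : ℝ) ^ Fintype.card V / (Nat.card (F ≃g F) : ℝ)) := by
  have h : (fun n : ℕ => ((graphCopies F (Fin n)).ncard : ℝ))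
      = fun n : ℕ => (n.descFactorial (Fintype.card V) : ℝ) / (Nat.card (F ≃g F) : ℝ) := by
    funext n
    rw [eq_div_iff (by exact_mod_cast (card_pos_aut F).ne')]
    exact_mod_cast ncard_graphCopies_mul hF hd n
  rw [h]
  exact (isEquivalent_descFactorial _).div IsEquivalent.refl

lemma tendsto_ncard_graphCopies (hF : IsStrictlyBalanced F) (hd : 0 < graphDensity F) :
    Tendsto (fun n : ℕ => (graphCopies F (Fin n)).ncard) atTop atTop := by
  have := nonempty_of_graphDensity_pos hd
  rw [← tendsto_natCast_atTop_iff (R := ℝ)]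
  refine (isEquivalent_ncard_graphCopies hF hd).symm.tendsto_atTop ?_
  exact ((tendsto_pow_atTop Fintype.card_ne_zero).comp tendsto_natCast_atTop_atTop).atTop_div_const
    (by exact_mod_cast card_pos_aut F)

/-- The main term of the binomial moments. -/
lemma tendsto_choose_mul_choose_div_choose (hF : IsStrictlyBalanced F)
    (hd : 0 < graphDensity F) (hm_top : Tendsto m atTop atTop)
    (hm : (fun n : ℕ => (m n : ℝ)) ~[atTop]
      (fun n : ℕ => c * (n : ℝ) ^ (2 - 1 / graphDensity F))) (r : ℕ) :
    Tendsto (fun n : ℕ => ((graphCopies F (Fin n)).ncard.choose r : ℝ) *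
      (((m n).choose (r * F.edgeSet.ncard) : ℝ)
        / ((n.choose 2).choose (r * F.edgeSet.ncard) : ℝ))) atTop
      (𝓝 (((2 * c) ^ F.edgeSet.ncard / (Nat.card (F ≃g F) : ℝ)) ^ r / r.factorial)) := by
  set l := F.edgeSet.ncard with hl
  have ha : (Nat.card (F ≃g F) : ℝ) ≠ 0 := by exact_mod_cast (card_pos_aut F).ne'
  set a := (Nat.card (F ≃g F) : ℝ) with hadef
  have h1 := ((isEquivalent_choose r).comp_tendsto (tendsto_ncard_graphCopies hF hd)).trans
    (((isEquivalent_ncard_graphCopies hF hd).pow r).div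
      (IsEquivalent.refl (u := fun _ => (r.factorial : ℝ))))
  have h2 := h1.mul (IsEquivalent.refl (u := fun n : ℕ => (((m n).choose (r * l) : ℝ)
        / ((n.choose 2).choose (r * l) : ℝ))) (l := atTop))
  have h3 := (tendsto_rpow_mul_choose_div_choose hm_top hm (r * l)).div_const
    (a ^ r * r.factorial)
  have h4 : ((2 * c) ^ l / a) ^ r / r.factorial = (2 * c) ^ (r * l) / (a ^ r * r.factorial) := by
    rw [div_pow, ← pow_mul, mul_comm l r, div_div]
  rw [h4]
  refine h2.symm.tendsto_nhds (h3.congr fun n => ?_)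
  -- Since l = d |V|, the powers of n in the number of families and in the probability cancel
  -- exactly.
  have h5 : ((r * l : ℕ) : ℝ) / graphDensity F = ((Fintype.card V * r : ℕ) : ℝ) := by
    rw [div_eq_iff hd.ne']
    push_cast
    rw [hl, ← graphDensity_mul_card hd]
    ring
  simp only [Pi.mul_apply, Pi.div_apply, Pi.pow_apply]
  rw [h5, Real.rpow_natCast, div_pow, ← pow_mul, ← hadef, div_div]
  ring

-- Each overlapping family is charged twice: for its true probability, and for the value it would
-- have if disjoint, which the main term assigns to it.
open Classical in
lemma sum_not_pairwiseDisjoint_le (hF : IsStrictlyBalanced F) (hd : 0 < graphDensity F)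
    (n r : ℕ) (p : ℕ → ℝ) (hp : ∀ e, 0 ≤ p e) :
    ∑ S ∈ ((graphCopies F (Fin n)).toFinset.powersetCard r).filter
        (fun S : Finset (SimpleGraph (Fin n)) =>
          ¬ (S : Set (SimpleGraph (Fin n))).PairwiseDisjoint SimpleGraph.support),
      (p (S.sup id).edgeSet.ncard + p (r * F.edgeSet.ncard))
    ≤ ∑ v ∈ Finset.range (r * Fintype.card V + 1),
        ∑ e ∈ Finset.range (r * F.edgeSet.ncard + 1) with graphDensity F * v < (e : ℕ),
          2 * (Fintype.card (Finset (SimpleGraph (Fin v))) : ℝ) * (n ^ v * p e) := by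
  set T := ((graphCopies F (Fin n)).toFinset.powersetCard r).filter
    (fun S : Finset (SimpleGraph (Fin n)) =>
      ¬ (S : Set (SimpleGraph (Fin n))).PairwiseDisjoint SimpleGraph.support) with hTdef
  have hT : ∀ S ∈ T, (∀ B ∈ S, B ∈ graphCopies F (Fin n)) ∧ S.card = r ∧
      ¬ (S : Set (SimpleGraph (Fin n))).PairwiseDisjoint SimpleGraph.support := by
    intro S hS
    rw [hTdef, Finset.mem_filter, Finset.mem_powersetCard] at hS
    exact ⟨fun B hB => Set.mem_toFinset.1 (hS.1.1 hB), hS.1.2, hS.2⟩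
  have hv : ∀ S ∈ T, (S.sup id).support.ncard ∈ Finset.range (r * Fintype.card V + 1) := by
    intro S hS
    obtain ⟨h1, h2, -⟩ := hT S hS
    rw [Finset.mem_range, Nat.lt_succ_iff, ← h2]
    exact ncard_support_sup_finset_le fun B hB => ncard_support_of_mem_graphCopies hF hd (h1 B hB)
  rw [← Finset.sum_fiberwise_of_maps_to hv]
  refine Finset.sum_le_sum fun v _ => ?_
  set E := (Finset.range (r * F.edgeSet.ncard + 1)).filter fun e : ℕ => graphDensity F * v < e
  have hbound : ∀ S ∈ T.filter (fun S => (S.sup id).support.ncard = v),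
      p (S.sup id).edgeSet.ncard + p (r * F.edgeSet.ncard) ≤ 2 * ∑ e ∈ E, p e := by
    intro S hS
    have hS' := Finset.mem_filter.1 hS
    obtain ⟨h1, h2, h3⟩ := hT S hS'.1
    have h4 := excess_sup_finset_pos hF hd h1 h3
    rw [excess, sub_pos, hS'.2] at h4
    have h5 : (S.sup id).edgeSet.ncard ≤ r * F.edgeSet.ncard := by
      rw [← h2]
      exact ncard_edgeSet_sup_finset_le fun B hB => ncard_edgeSet_of_mem_graphCopies (h1 B hB)
    have h6 : (S.sup id).edgeSet.ncard ∈ E :=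
      Finset.mem_filter.2 ⟨by rw [Finset.mem_range]; omega, h4⟩
    -- The value for disjoint copies is also negligible here: r·l is at least the number of edges of
    -- the union, hence exceeds d·v.
    have h7 : r * F.edgeSet.ncard ∈ E :=
      Finset.mem_filter.2 ⟨by rw [Finset.mem_range]; omega, h4.trans_le (Nat.cast_le.2 h5)⟩
    have h8 := Finset.single_le_sum (fun e _ => hp e) h6
    have h9 := Finset.single_le_sum (fun e _ => hp e) h7
    linarith
  refine (Finset.sum_le_card_nsmul _ _ _ hbound).trans ?_
  have hcard := card_filter_support_le v n (T.filter (fun S => (S.sup id).support.ncard = v))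
    fun S hS => (Finset.mem_filter.1 hS).2
  have hcard' : ((T.filter (fun S => (S.sup id).support.ncard = v)).card : ℝ)
      ≤ (Fintype.card (Finset (SimpleGraph (Fin v))) : ℝ) * n ^ v := by exact_mod_cast hcard
  have hnonneg : 0 ≤ 2 * ∑ e ∈ E, p e := mul_nonneg zero_le_two (Finset.sum_nonneg fun e _ => hp e)
  rw [nsmul_eq_mul]
  refine (mul_le_mul_of_nonneg_right hcard' hnonneg).trans_eq ?_
  rw [Finset.mul_sum, Finset.mul_sum]
  refine Finset.sum_congr rfl fun e _ => ?_
  ring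

lemma tendsto_overlap_bound (hd : 0 < graphDensity F) (hm_top : Tendsto m atTop atTop)
    (hm : (fun n : ℕ => (m n : ℝ)) ~[atTop]
      (fun n : ℕ => c * (n : ℝ) ^ (2 - 1 / graphDensity F))) (r : ℕ) :
    Tendsto (fun n : ℕ => ∑ v ∈ Finset.range (r * Fintype.card V + 1),
      ∑ e ∈ Finset.range (r * F.edgeSet.ncard + 1) with graphDensity F * v < (e : ℕ),
        2 * (Fintype.card (Finset (SimpleGraph (Fin v))) : ℝ) *
          ((n : ℝ) ^ v * (((m n).choose e : ℝ) / ((n.choose 2).choose e : ℝ)))) atTop (𝓝 0) := by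
  have h := tendsto_finsetSum (Finset.range (r * Fintype.card V + 1)) fun v _ =>
    tendsto_finsetSum
      ((Finset.range (r * F.edgeSet.ncard + 1)).filter fun e : ℕ => graphDensity F * v < e)
      fun e he => (tendsto_pow_mul_choose_div_choose_zero hd hm_top hm
        (Finset.mem_filter.1 he).2).const_mul
          (2 * (Fintype.card (Finset (SimpleGraph (Fin v))) : ℝ))
  simpa only [mul_zero, Finset.sum_const_zero] using h

/-- The binomial moments of the number of copies of `F` converge to those of the Poisson law. -/
lemma tendsto_nmExp_choose_copyCount (hF : IsStrictlyBalanced F)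
    (hd : 0 < graphDensity F) (hm_top : Tendsto m atTop atTop)
    (hm : (fun n : ℕ => (m n : ℝ)) ~[atTop]
      (fun n : ℕ => c * (n : ℝ) ^ (2 - 1 / graphDensity F))) (r : ℕ) :
    Tendsto (fun n : ℕ => nmExp n (m n) (fun G => ((G.copyCount F).choose r : ℝ))) atTop
      (𝓝 (((2 * c) ^ F.edgeSet.ncard / (Nat.card (F ≃g F) : ℝ)) ^ r / r.factorial)) := by
  classical
  set p : ℕ → ℕ → ℝ := fun n e => ((m n).choose e : ℝ) / ((n.choose 2).choose e : ℝ) with hpdef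
  have hp : ∀ n e, 0 ≤ p n e := fun n e => by positivity
  set R : ℕ → ℝ := fun n => ∑ v ∈ Finset.range (r * Fintype.card V + 1),
    ∑ e ∈ Finset.range (r * F.edgeSet.ncard + 1) with graphDensity F * v < (e : ℕ),
      2 * (Fintype.card (Finset (SimpleGraph (Fin v))) : ℝ) * ((n : ℝ) ^ v * p n e) with hR
  have hR0 : Tendsto R atTop (𝓝 0) := tendsto_overlap_bound hd hm_top hm r
  have hmain := tendsto_choose_mul_choose_div_choose hF hd hm_top hm r
  refine tendsto_of_tendsto_of_dist hmain (squeeze_zero' (Eventually.of_forall fun _ => dist_nonneg) ?_ hR0)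
  -- These two conditions let `nmProb_ge` apply to every union of `r` copies.
  filter_upwards [eventually_le_choose_two hd hm,
    hm_top.eventually_ge_atTop (r * F.edgeSet.ncard)] with n hn1 hn2
  refine le_trans ?_ (sum_not_pairwiseDisjoint_le hF hd n r (p n) (hp n))
  set P := (graphCopies F (Fin n)).toFinset.powersetCard r with hP
  have hmem : ∀ S ∈ P, (∀ B ∈ S, B.edgeSet.ncard = F.edgeSet.ncard) ∧ S.card = r := by
    intro S hS
    rw [hP, Finset.mem_powersetCard] at hS
    exact ⟨fun B hB => ncard_edgeSet_of_mem_graphCopies (Set.mem_toFinset.1 (hS.1 hB)), hS.2⟩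
  have hexp : nmExp n (m n) (fun G => ((G.copyCount F).choose r : ℝ))
      = ∑ S ∈ P, p n (S.sup id).edgeSet.ncard := by
    rw [nmExp_choose_copyCount hF hd]
    refine Finset.sum_congr rfl fun S hS => ?_
    obtain ⟨h1, h2⟩ := hmem S hS
    exact nmProb_ge _ (((ncard_edgeSet_sup_finset_le h1).trans_eq (by rw [h2])).trans hn2) hn1
  -- The main term treats all `r`-families as disjoint. The two sums differ only on overlapping
  -- families, so disjoint ones need not be counted.
  have hall : ((graphCopies F (Fin n)).ncard.choose r : ℝ) * p n (r * F.edgeSet.ncard)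
      = ∑ S ∈ P, p n (r * F.edgeSet.ncard) := by
    rw [Finset.sum_const, nsmul_eq_mul, hP, Finset.card_powersetCard, Set.ncard_eq_toFinset_card']
  rw [hexp, hall, Real.dist_eq, ← Finset.sum_sub_distrib, Finset.sum_filter]
  refine (Finset.abs_sum_le_sum_abs _ _).trans (Finset.sum_le_sum fun S hS => ?_)
  obtain ⟨h1, h2⟩ := hmem S hS
  split_ifs with hdisj
  · rw [ncard_edgeSet_sup_finset_eq h1 hdisj, h2, sub_self, abs_zero]
  · refine (abs_sub _ _).trans_eq ?_
    rw [abs_of_nonneg (hp _ _), abs_of_nonneg (hp _ _), add_comm]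

end Moments

/-! ### From binomial moments to point probabilities -/

theorem mainTheorem5 {V : Type*} [Fintype V] (F : SimpleGraph V)
    (hF : IsStrictlyBalanced F) (hd : 0 < graphDensity F)
    (c : ℝ) (hc : 0 < c) (m : ℕ → ℕ) (hm_top : Tendsto m atTop atTop)
    (hm : (fun n : ℕ => (m n : ℝ)) ~[atTop]
      (fun n : ℕ => c * (n : ℝ) ^ (2 - 1 / graphDensity F)))
    (lam : ℝ) (hlam : lam = (2 * c) ^ F.edgeSet.ncard / (Nat.card (F ≃g F) : ℝ)) (t : ℕ) :
    Tendsto (fun n : ℕ => nmProb n (m n) (fun G => G.copyCount F = t)) atTop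
      (𝓝 (lam ^ t / (t.factorial : ℝ) * Real.exp (-lam))) := by
  classical
  have hmom := tendsto_nmExp_choose_copyCount hF hd hm_top hm
  rw [← hlam] at hmom
  have hsum : ∀ J, Tendsto
      (fun n => nmExp n (m n) (fun G => bonferroniSum (G.copyCount F) t J)) atTop
      (𝓝 (∑ j ∈ Finset.range (J + 1),
        (-1 : ℝ) ^ j * (t + j).choose t * (lam ^ (t + j) / (t + j).factorial))) := by
    intro J
    simp only [bonferroniSum, nmExp_sum, nmExp_const_mul]
    exact tendsto_finsetSum _ fun j _ => (hmom (t + j)).const_mul _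
  have hlim := tendsto_poisson_partial_sum lam t
  -- Odd truncations bound the probability from below, even ones from above.
  refine tendsto_of_forall_le_of_forall_le (fun i n => ?_) (fun i n => ?_)
    (fun i => hsum (2 * i + 1)) (fun i => hsum (2 * i)) (hlim.comp ?_) (hlim.comp ?_)
  · rw [nmProb_eq_nmExp]
    refine nmExp_mono fun G => (bonferroniSum_le_indicator _ t i).trans_eq ?_
    congr
  · rw [nmProb_eq_nmExp]
    refine nmExp_mono fun G => (Eq.le ?_).trans (indicator_le_bonferroniSum _ t i)
    congr
  · exact tendsto_atTop_mono (fun i => by simp only [id]; omega) tendsto_id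
  · exact tendsto_atTop_mono (fun i => by simp only [id]; omega) tendsto_id
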